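/- **Theorem 1.2.** A hypergraph is connected if its shadow graph (same vertex set, two distinct vertices adjacent when some edge contains both) is connected; a component is a maximal connected subgraph. For an $r$-coloring $\chi$ of the edges of a hypergraph $H$, let $\mathrm{mc}(H,\chi)$ be the largest number of vertices in a component of one of the hypergraphs $H_1,\dots,H_r$, where $H_i$ has the vertex set of $H$ and the edges of color $i$, and let $\mathrm{mc}_r(H)=\min_\chi \mathrm{mc}(H,\chi)$ over all $r$-colorings $\chi$ of the edges of $H$. Let $\mathcal H^{(k)}(n,p)$ be the random $k$-uniform hypergraph on $[n]$ in which each $k$-element subset of $[n]$ is an edge independently with probability $p$. Suppose that a real-valued function $\varphi=\varphi(r,k)$ satisfies the following condition: for all integers $k\ge 2$, $r\ge 1$ and all $\alpha^*>0$ there exist $\epsilon^*>0$ and $t_0>0$ such that every $k$-uniform hypergraph $G$ on $t\ge t_0$ vertices with at least $(1-\epsilon^*)\binom{t}{k}$ edges satisfies $\mathrm{mc}_r(G)\ge(\varphi(r,k)-\alpha^*)t$. Then for all integers $k\ge 2$, $r\ge 1$, all $\alpha>0$, and all $p=p(n)\in[0,1]$ with $p(n)\,n^{k-1}\to\infty$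 as $n\to\infty$, $$\lim_{n\to\infty}\Pr\left[\mathrm{mc}_r\left(\mathcal H^{(k)}(n,p(n))\right)\ge(\varphi(r,k)-\alpha)n\right]=1 .$$ -/

import Mathlib

open Filter Topology

namespace Hypergraph

/-- Every edge of `H` has exactly `k` elements. -/
def IsUniform {V : Type*} (H : Hypergraph V) (k : ℕ) : Prop :=
  ∀ e ∈ H.edgeSet, e.encard = k

/-- The shadow graph of `H`: its vertices are those of `H`, and two distinct vertices are joined
if and only if some edge of `H` contains both. -/
def shadowGraph {V : Type*} (H : Hypergraph V) : SimpleGraph H.vertexSet where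
  Adj x y := x ≠ y ∧ ∃ e ∈ H.edgeSet, (x : V) ∈ e ∧ (y : V) ∈ e
  symm := ⟨fun _ _ ⟨hne, e, he, hx, hy⟩ => ⟨hne.symm, e, he, hy, hx⟩⟩
  loopless := ⟨fun _ h => h.1 rfl⟩

/-- A hypergraph is connected if its shadow graph is (in particular it has a vertex). -/
def IsConnected {V : Type*} (H : Hypergraph V) : Prop :=
  H.shadowGraph.Connected

/-- `C` is a subgraph of `H`. -/
def IsSubgraph {V : Type*} (C H : Hypergraph V) : Prop :=
  C.vertexSet ⊆ H.vertexSet ∧ C.edgeSet ⊆ H.edgeSet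

/-- `C` is a component of `H`: a maximal connected subgraph. -/
def IsComponent {V : Type*} (C H : Hypergraph V) : Prop :=
  C.IsSubgraph H ∧ C.IsConnected ∧
    ∀ D : Hypergraph V, D.IsSubgraph H → D.IsConnected → C.IsSubgraph D → D = C

/-- The hypergraph on the vertex set of `H` whose edges are the edges of colour `i`. -/
def colorClass {V : Type*} (H : Hypergraph V) {r : ℕ} (χ : H.edgeSet → Fin r) (i : Fin r) :
    Hypergraph V where
  vertexSet := H.vertexSet
  edgeSet := {e | ∃ he : e ∈ H.edgeSet, χ ⟨e, he⟩ = i}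
  subset_vertexSet_of_mem_edgeSet' := fun _ he => H.subset_vertexSet_of_mem_edgeSet' he.1

/-- The order of the largest monochromatic component of `H` under the colouring `χ`
(for a hypergraph with finitely many vertices, so that the supremum is a maximum). -/
noncomputable def mc {V : Type*} (H : Hypergraph V) {r : ℕ} (χ : H.edgeSet → Fin r) : ℕ :=
  sSup {m : ℕ | ∃ (i : Fin r) (C : Hypergraph V),
    C.IsComponent (H.colorClass χ i) ∧ C.vertexSet.ncard = m}

/-- The minimum of `mc H χ` over all `r`-colourings `χ` of the edges of `H` (with `1 ≤ r`). -/
noncomputable def minMc {V : Type*} (r : ℕ) (H : Hypergraph V) : ℕ :=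
  ⨅ χ : H.edgeSet → Fin r, H.mc χ

/-- The hypergraph with vertex set all of `V` and the given edges. -/
def ofEdges {V : Type*} (S : Set (Set V)) : Hypergraph V where
  vertexSet := Set.univ
  edgeSet := S
  subset_vertexSet_of_mem_edgeSet' := fun _ _ => Set.subset_univ _

/-- The law of the edge set of the random `k`-uniform hypergraph on the vertex set `Fin n`: each
`k`-element subset of `Fin n` is an edge independently with probability `p`, and no other set is
an edge. -/
noncomputable def randomEdges (k n : ℕ) (p : unitInterval) :
    MeasureTheory.Measure (Set (Set (Fin n))) :=
  ProbabilityTheory.setBernoulli {e : Set (Fin n) | e.encard = k} p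

end Hypergraph

open MeasureTheory ProbabilityTheory

namespace Hypergraph

/-! The proof is a union bound over partitions. If some colouring has only components of size at
most `M = ⌊c n⌋`, with `c = φ r k - α > 0`, the components of each colour can be merged into at most
`m` parts of size at most `M`, with `m` independent of `n` (`exists_coarsening`,
`exists_partitions`). Every edge then lies inside a part of one of `r` such partitions.

For fixed partitions, the hypergraph of all `k`-sets inside parts has `minMc` at most `M`
(`minMc_monoSets_le`), so the hypothesis on `φ` forces it to miss at least `ε * n.choose k` of the
`k`-sets. The random hypergraph must avoid all of these, which has probability at most `exp (-p * ε
* n.choose k)`. There are at most `m ^ (r * n)` choices of partitions, and `p * n ^ (k - 1) → ∞`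
makes the decay win (`randomEdges_minMc_le`). -/

/-- A partition into parts of size at most `M`, given as the fibres of `f`, can be coarsened to one
whose parts still have size at most `M` and which has at most `2 |V| / (M + 1) + 1` parts. -/
lemma exists_coarsening {V : Type*} [Fintype V] [DecidableEq V] (M : ℕ) (f : V → V)
    (hf : ∀ a, (Finset.univ.filter fun x => f x = a).card ≤ M) :
    ∃ g : V → V, (∀ x y, f x = f y → g x = g y) ∧
      (∀ a, (Finset.univ.filter fun x => g x = a).card ≤ M) ∧
      (Finset.univ.image g).card ≤ 2 * Fintype.card V / (M + 1) + 1 := by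
  induction hK : (Finset.univ.image f).card using Nat.strong_induction_on generalizing f with
  | _ K ih =>
  subst hK
  set s : V → ℕ := fun a => (Finset.univ.filter fun x => f x = a).card with hs
  -- Greedy merging: while two parts together fit in size `M`, unite them; the number of parts
  -- drops.
  by_cases hmerge : ∃ a ∈ Finset.univ.image f, ∃ b ∈ Finset.univ.image f, a ≠ b ∧ s a + s b ≤ M
  · obtain ⟨a, ha, b, hb, hab, hsum⟩ := hmerge
    set f' : V → V := fun x => if f x = a then b else f x with hf'
    have hfib : ∀ c, (Finset.univ.filter fun x => f' x = c).card ≤ M := by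
      intro c
      by_cases hc : c = b
      · refine le_trans (le_trans (Finset.card_le_card ?_) (Finset.card_union_le
          (Finset.univ.filter fun x => f x = a) (Finset.univ.filter fun x => f x = b))) hsum
        intro x hx
        simp only [hf', Finset.mem_filter, Finset.mem_univ, true_and, Finset.mem_union] at hx ⊢
        split_ifs at hx with h
        · exact Or.inl h
        · exact Or.inr (hx.trans hc)
      · refine le_trans (Finset.card_le_card ?_) (hf c)
        intro x hx
        simp only [hf', Finset.mem_filter, Finset.mem_univ, true_and] at hx ⊢
        split_ifs at hx with h
        · exact absurd hx.symm hc
        · exact hx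
    have himg : Finset.univ.image f' ⊆ (Finset.univ.image f).erase a := by
      intro c hc
      obtain ⟨x, -, rfl⟩ := Finset.mem_image.1 hc
      simp only [hf']
      split_ifs with h
      · exact Finset.mem_erase.2 ⟨hab.symm, hb⟩
      · exact Finset.mem_erase.2 ⟨h, Finset.mem_image_of_mem _ (Finset.mem_univ _)⟩
    have hlt : (Finset.univ.image f').card < (Finset.univ.image f).card :=
      lt_of_le_of_lt (Finset.card_le_card himg) (Finset.card_erase_lt_of_mem ha)
    obtain ⟨g, hg, hgM, hgK⟩ := ih _ hlt f' hfib rfl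
    exact ⟨g, fun x y hxy => hg x y (by simp only [hf', hxy]), hgM, hgK⟩
  · push Not at hmerge
    refine ⟨f, fun _ _ h => h, hf, ?_⟩
    -- Two parts of size at most `M / 2` could still be merged, so at most one is left.
    have hsmall : ((Finset.univ.image f).filter fun a => ¬ M + 1 ≤ 2 * s a).card ≤ 1 := by
      rw [Finset.card_le_one]
      intro a ha b hb
      by_contra hne
      rw [Finset.mem_filter] at ha hb
      have := hmerge a ha.1 b hb.1 hne
      omega
    have hbig : ((Finset.univ.image f).filter fun a => M + 1 ≤ 2 * s a).card * (M + 1)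
        ≤ 2 * Fintype.card V := by
      rw [← smul_eq_mul]
      refine (Finset.card_nsmul_le_sum _ (fun a => 2 * s a) _ fun a ha =>
        (Finset.mem_filter.1 ha).2).trans ?_
      rw [← Finset.mul_sum]
      refine Nat.mul_le_mul_left _ ?_
      refine (Finset.sum_le_sum_of_subset (Finset.filter_subset _ _)).trans ?_
      exact (Finset.card_eq_sum_card_image f Finset.univ).ge
    have := Finset.card_filter_add_card_filter_not (s := Finset.univ.image f)
      (fun a => M + 1 ≤ 2 * s a)
    have := (Nat.le_div_iff_mul_le (Nat.add_one_pos M)).2 hbig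
    omega

/-! ### Components and the partitions they induce -/

/-- The vertices reachable from a given one form the vertex set of a component. -/
lemma exists_isComponent {V : Type*} (H : Hypergraph V) (x : H.vertexSet) :
    ∃ C : Hypergraph V, C.IsComponent H ∧
      C.vertexSet = {y | ∃ hy : y ∈ H.vertexSet, H.shadowGraph.Reachable x ⟨y, hy⟩} := by
  set W : Set V := {y | ∃ hy : y ∈ H.vertexSet, H.shadowGraph.Reachable x ⟨y, hy⟩} with hW
  let C : Hypergraph V :=
    { vertexSet := W
      edgeSet := {e | e ∈ H.edgeSet ∧ e ⊆ W}
      subset_vertexSet_of_mem_edgeSet' := fun _ he => he.2 }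
  have hxW : (x : V) ∈ W := ⟨x.2, SimpleGraph.Reachable.refl _⟩
  -- An edge meeting `W` lies inside `W`, so walks of `H` starting in `W` survive in `C`.
  have key : ∀ u v : H.vertexSet, H.shadowGraph.Walk u v → ∀ hu : (u : V) ∈ W,
      ∃ hv : (v : V) ∈ W, C.shadowGraph.Reachable ⟨u, hu⟩ ⟨v, hv⟩ := by
    intro u v w
    induction w with
    | nil => exact fun hu => ⟨hu, SimpleGraph.Reachable.refl _⟩
    | @cons a b c h q ih =>
      intro hu
      obtain ⟨hne, e, he, hae, hbe⟩ := h
      have heW : e ⊆ W := by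
        intro z hz
        have hzH := H.subset_vertexSet_of_mem_edgeSet' he hz
        refine ⟨hzH, hu.2.trans ?_⟩
        by_cases haz : a = ⟨z, hzH⟩
        · rw [← haz]
        · exact SimpleGraph.Adj.reachable ⟨haz, e, he, hae, hz⟩
      obtain ⟨hv, hr⟩ := ih (heW hbe)
      refine ⟨hv, SimpleGraph.Reachable.trans (SimpleGraph.Adj.reachable ?_) hr⟩
      exact ⟨fun h => hne (Subtype.ext (congrArg (fun z : C.vertexSet => (z : V)) h)),
        e, ⟨he, heW⟩, hae, hbe⟩
  refine ⟨C, ⟨⟨fun y hy => hy.1, fun e he => he.1⟩, ?_, ?_⟩, rfl⟩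
  · have hreach : ∀ y : C.vertexSet, C.shadowGraph.Reachable ⟨x, hxW⟩ y := by
      rintro ⟨y, hy⟩
      obtain ⟨w⟩ := hy.2
      exact (key _ _ w hxW).2
    exact (SimpleGraph.connected_iff_exists_forall_reachable _).2 ⟨_, hreach⟩
  · intro D hDH hD hCD
    have hv : D.vertexSet = W := by
      refine Set.Subset.antisymm (fun y hy => ⟨hDH.1 hy, ?_⟩) hCD.1
      let F : D.shadowGraph →g H.shadowGraph :=
        { toFun := fun z => ⟨z, hDH.1 z.2⟩
          map_rel' := by
            rintro a b ⟨hne, e, he, ha, hb⟩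
            exact ⟨fun h => hne (Subtype.ext (congrArg (fun z : H.vertexSet => (z : V)) h)),
              e, hDH.2 he, ha, hb⟩ }
      exact (hD.preconnected ⟨x, hCD.1 hxW⟩ ⟨y, hy⟩).map F
    refine Hypergraph.ext hv (Set.Subset.antisymm (fun e he => ⟨hDH.2 he, ?_⟩) hCD.2)
    exact hv ▸ D.subset_vertexSet_of_mem_edgeSet' he

/-- A function that is constant on every edge is constant on connected subgraphs. -/
lemma IsConnected.apply_eq {V β : Type*} {C : Hypergraph V} (hC : C.IsConnected) (f : V → β)
    (hf : ∀ e ∈ C.edgeSet, ∀ x ∈ e, ∀ y ∈ e, f x = f y) {x y : V} (hx : x ∈ C.vertexSet)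
    (hy : y ∈ C.vertexSet) : f x = f y := by
  obtain ⟨w⟩ := hC.preconnected ⟨x, hx⟩ ⟨y, hy⟩
  have : ∀ u v : C.vertexSet, C.shadowGraph.Walk u v → f u = f v := by
    intro u v w
    induction w with
    | nil => rfl
    | cons h _ ih =>
      obtain ⟨-, e, he, ha, hb⟩ := h
      exact (hf e he _ ha _ hb).trans ih
  exact this _ _ w

/-- If all components of `H` have at most `M` vertices, some function has fibres of size at most
`M` and is constant on the edges of `H`. -/
lemma exists_fiber_card_le {V : Type*} [Fintype V] [DecidableEq V] (H : Hypergraph V)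
    (hH : H.vertexSet = Set.univ) (M : ℕ)
    (hM : ∀ C : Hypergraph V, C.IsComponent H → C.vertexSet.ncard ≤ M) :
    ∃ f : V → V, (∀ a, (Finset.univ.filter fun x => f x = a).card ≤ M) ∧
      ∀ e ∈ H.edgeSet, ∀ x ∈ e, ∀ y ∈ e, f x = f y := by
  have hmem : ∀ x, x ∈ H.vertexSet := fun x => hH ▸ Set.mem_univ x
  let c : V → H.shadowGraph.ConnectedComponent := fun x =>
    H.shadowGraph.connectedComponentMk ⟨x, hmem x⟩
  refine ⟨fun x => ((c x).out : V), fun a => ?_, fun e he x hx y hy => ?_⟩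
  · rcases (Finset.univ.filter fun x => ((c x).out : V) = a).eq_empty_or_nonempty with h0 | ⟨x, hx⟩
    · simp only [h0, Finset.card_empty, Nat.zero_le]
    obtain ⟨C, hC, hCv⟩ := H.exists_isComponent ⟨x, hmem x⟩
    refine le_trans ?_ (hM C hC)
    rw [← Set.ncard_coe_finset]
    refine Set.ncard_le_ncard ?_ (Set.toFinite _)
    intro y hy
    rw [hCv]
    refine ⟨hmem y, ?_⟩
    rw [← SimpleGraph.ConnectedComponent.eq]
    have hx' := (Finset.mem_filter.1 hx).2
    have hy' := (Finset.mem_filter.1 (Finset.mem_coe.1 hy)).2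
    have h := Subtype.ext (hx'.trans hy'.symm)
    calc c x = H.shadowGraph.connectedComponentMk (c x).out := (Quot.out_eq _).symm
      _ = H.shadowGraph.connectedComponentMk (c y).out := by rw [h]
      _ = c y := Quot.out_eq _
  · have : c x = c y := by
      by_cases hxy : x = y
      · rw [hxy]
      · exact SimpleGraph.ConnectedComponent.sound (SimpleGraph.Adj.reachable
          ⟨fun h => hxy (congrArg (fun z : H.vertexSet => (z : V)) h), e, he, hx, hy⟩)
    simp only [this]

lemma ncard_le_mc {V : Type*} [Finite V] (H : Hypergraph V) {r : ℕ} (χ : H.edgeSet → Fin r)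
    (i : Fin r) (C : Hypergraph V) (hC : C.IsComponent (H.colorClass χ i)) :
    C.vertexSet.ncard ≤ H.mc χ := by
  refine le_csSup ⟨Nat.card V, ?_⟩ ⟨i, C, hC, rfl⟩
  rintro m ⟨_, D, -, rfl⟩
  exact Set.ncard_le_card _

/-- The sets of size `k` on which some `g i` is constant. -/
def monoSets {V β : Type*} {r : ℕ} (k : ℕ) (g : Fin r → V → β) : Set (Set V) :=
  {e | e.encard = k ∧ ∃ i, ∀ x ∈ e, ∀ y ∈ e, g i x = g i y}

/-- Colour each edge by an index `i` for which `g i` is constant on it; a component of colour `i`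
then stays inside one fibre of `g i`. -/
lemma minMc_monoSets_le {V β : Type*} [Fintype V] [DecidableEq β] {r : ℕ} (k M : ℕ)
    (g : Fin r → V → β) (hg : ∀ i b, (Finset.univ.filter fun x => g i x = b).card ≤ M) :
    (ofEdges (monoSets k g)).minMc r ≤ M := by
  set G := ofEdges (monoSets k g)
  let χ : G.edgeSet → Fin r := fun e => e.2.2.choose
  have hχ : ∀ e : G.edgeSet, ∀ x ∈ e.1, ∀ y ∈ e.1, g (χ e) x = g (χ e) y :=
    fun e => e.2.2.choose_spec
  refine (ciInf_le (OrderBot.bddBelow _) χ).trans (csSup_le' ?_)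
  rintro m ⟨i, C, hC, rfl⟩
  obtain ⟨⟨x, hx⟩⟩ := hC.2.1.nonempty
  refine le_trans ?_ (hg i (g i x))
  rw [← Set.ncard_coe_finset]
  refine Set.ncard_le_ncard (fun y hy => ?_) (Set.toFinite _)
  rw [Finset.mem_coe, Finset.mem_filter]
  refine ⟨Finset.mem_univ _, hC.2.1.apply_eq (g i) (fun e he => ?_) hy hx⟩
  obtain ⟨he', hi⟩ := hC.1.2 he
  have := hχ ⟨e, he'⟩
  rwa [hi] at this

/-- A hypergraph with a colouring without large monochromatic components comes with boundedly many
bounded parts for each colour, such that each edge is contained in a part. -/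
lemma exists_partitions {V : Type*} [Fintype V] [DecidableEq V] (H : Hypergraph V)
    (hH : H.vertexSet = Set.univ) {r : ℕ} (hr : 1 ≤ r) (M m : ℕ) (hM : H.minMc r ≤ M)
    (hm : 2 * Fintype.card V / (M + 1) + 1 ≤ m) :
    ∃ g : Fin r → V → Fin m, (∀ i b, (Finset.univ.filter fun x => g i x = b).card ≤ M) ∧
      ∀ e ∈ H.edgeSet, ∃ i, ∀ x ∈ e, ∀ y ∈ e, g i x = g i y := by
  have : Nonempty (H.edgeSet → Fin r) := ⟨fun _ => ⟨0, hr⟩⟩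
  obtain ⟨χ, hχ⟩ : ∃ χ : H.edgeSet → Fin r, H.mc χ = H.minMc r :=
    Nat.sInf_mem (Set.range_nonempty _)
  have key : ∀ i : Fin r, ∃ g : V → Fin m,
      (∀ b, (Finset.univ.filter fun x => g x = b).card ≤ M) ∧
      ∀ e ∈ (H.colorClass χ i).edgeSet, ∀ x ∈ e, ∀ y ∈ e, g x = g y := by
    intro i
    obtain ⟨f, hf, hfe⟩ := (H.colorClass χ i).exists_fiber_card_le hH M
      fun C hC => (H.ncard_le_mc χ i C hC).trans (hχ.trans_le hM)
    obtain ⟨g, hfg, hgM, hgK⟩ := exists_coarsening M f hf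
    obtain ⟨ι⟩ : Nonempty (Finset.univ.image g ↪ Fin m) := by
      rw [Function.Embedding.nonempty_iff_card_le, Fintype.card_coe, Fintype.card_fin]
      exact hgK.trans hm
    let g' : V → Fin m := fun x => ι ⟨g x, Finset.mem_image_of_mem _ (Finset.mem_univ _)⟩
    have hg' : ∀ x y, g' x = g' y ↔ g x = g y := fun x y => by
      simp only [g', ι.injective.eq_iff, Subtype.mk.injEq]
    refine ⟨g', fun b => ?_, fun e he x hx y hy => (hg' x y).2 (hfg x y (hfe e he x hx y hy))⟩
    rcases (Finset.univ.filter fun x => g' x = b).eq_empty_or_nonempty with h0 | ⟨x, hx⟩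
    · simp only [h0, Finset.card_empty, Nat.zero_le]
    refine le_trans (Finset.card_le_card fun y hy => ?_) (hgM (g x))
    rw [Finset.mem_filter] at hx hy ⊢
    exact ⟨Finset.mem_univ _, (hg' y x).1 (hy.2.trans hx.2.symm)⟩
  choose g hg hge using key
  exact ⟨g, hg, fun e he => ⟨χ ⟨e, he⟩, hge _ e ⟨he, rfl⟩⟩⟩

/-! ### The union bound for the random hypergraph -/

/-- The probability that the Bernoulli random subset of `u` misses `B ⊆ u`. -/
lemma setBernoulli_disjoint {ι : Type*} [Finite ι] (u B : Set ι) (hB : B ⊆ u)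
    (p : unitInterval) :
    setBernoulli u p {S | Disjoint S B} = ENNReal.ofReal ((1 - p) ^ B.ncard) := by
  have hfin : B.Finite := Set.toFinite B
  have hset : (fun q : ι → Prop => {i | q i}) ⁻¹' {S | Disjoint S B}
      = Set.pi (hfin.toFinset : Set ι) fun _ => {False} := by
    ext q
    simp only [Set.mem_preimage, Set.mem_ofPred_eq, Set.disjoint_right, Set.mem_pi,
      Set.Finite.coe_toFinset, Set.mem_singleton_iff, eq_iff_iff, iff_false]
  rw [setBernoulli_apply', hset, Measure.infinitePi_pi _ (fun _ _ => MeasurableSet.of_discrete)]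
  have hone : ∀ i ∈ hfin.toFinset,
      (unitInterval.toNNReal p • Measure.dirac (i ∈ u) +
        unitInterval.toNNReal (unitInterval.symm p) • Measure.dirac False : Measure Prop) {False}
      = ENNReal.ofReal (1 - p) := by
    intro i hi
    have hiu : i ∈ u := hB (hfin.mem_toFinset.1 hi)
    have hp : (unitInterval.toNNReal (unitInterval.symm p) : ENNReal) = ENNReal.ofReal (1 - p) := by
      rw [← ENNReal.ofReal_coe_nnreal, unitInterval.coe_toNNReal, unitInterval.coe_symm_eq]
    rw [← hp]
    simp [hiu]
  rw [Finset.prod_congr rfl hone, Finset.prod_const, ← Set.ncard_eq_toFinset_card B hfin,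
    ENNReal.ofReal_pow (sub_nonneg.2 p.2.2)]

lemma ncard_setOf_encard_eq (n k : ℕ) :
    {e : Set (Fin n) | e.encard = k}.ncard = n.choose k := by
  have h : {e : Set (Fin n) | e.encard = k} = {e ⊆ Set.univ | e.ncard = k} := by
    ext e
    rw [Set.mem_ofPred_eq, Set.mem_ofPred_eq, ← (Set.toFinite e).cast_ncard_eq, Nat.cast_inj]
    exact ⟨fun h => ⟨Set.subset_univ _, h⟩, fun h => h.2⟩
  rw [h, Set.ncard_powerset_ncard Set.finite_univ, Set.ncard_univ, Nat.card_fin]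

/-- The probability that `minMc` is at most `M`, when hypergraphs covered by bounded parts miss
many sets of size `k`. -/
lemma randomEdges_minMc_le {n k r M m : ℕ} (hr : 1 ≤ r) (hm : 2 * n / (M + 1) + 1 ≤ m)
    (b : ℝ) (p : unitInterval)
    (hb : ∀ g : Fin r → Fin n → Fin m,
      (∀ i b, (Finset.univ.filter fun x => g i x = b).card ≤ M) →
      ((monoSets k g).ncard : ℝ) ≤ n.choose k - b) :
    randomEdges k n p {S | (ofEdges S).minMc r ≤ M} ≤
      ENNReal.ofReal (Real.exp (r * n * Real.log m - p * b)) := by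
  set u : Set (Set (Fin n)) := {e | e.encard = k} with hu
  let T : Finset (Fin r → Fin n → Fin m) := Finset.univ.filter fun g =>
      ∀ i b, (Finset.univ.filter fun x => g i x = b).card ≤ M
  have hm0 : 0 < m := (Nat.succ_pos _).trans_le hm
  have hsub : {S | (ofEdges S).minMc r ≤ M} ⊆ ⋃ g ∈ T, {S | Disjoint S (u \ monoSets k g)} := by
    intro S hS
    obtain ⟨g, hg, hge⟩ := (ofEdges S).exists_partitions rfl hr M m hS
      (by rwa [Fintype.card_fin])
    refine Set.mem_biUnion (x := g) (Finset.mem_coe.2 (Finset.mem_filter.2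
      ⟨Finset.mem_univ _, hg⟩)) ?_
    exact Set.disjoint_left.2 fun e he heB => heB.2 ⟨heB.1, hge e he⟩
  have hterm : ∀ g ∈ T, setBernoulli u p {S | Disjoint S (u \ monoSets k g)} ≤
      ENNReal.ofReal (Real.exp (-(p * b))) := by
    intro g hg
    rw [setBernoulli_disjoint u _ Set.sdiff_subset]
    refine ENNReal.ofReal_le_ofReal ?_
    have hcard : b ≤ ((u \ monoSets k g).ncard : ℝ) := by
      have h1 := hb g (Finset.mem_filter.1 hg).2
      have h2 : (u \ monoSets k g).ncard + (monoSets k g).ncard = u.ncard :=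
        Set.ncard_sdiff_add_ncard_of_subset (fun e he => he.1) (Set.toFinite _)
      rw [hu, ncard_setOf_encard_eq, ← hu] at h2
      have h3 : ((u \ monoSets k g).ncard : ℝ) + (monoSets k g).ncard = n.choose k := by
        exact_mod_cast h2
      linarith
    calc (1 - (p : ℝ)) ^ (u \ monoSets k g).ncard
        ≤ Real.exp (-p) ^ (u \ monoSets k g).ncard :=
          pow_le_pow_left₀ (sub_nonneg.2 p.2.2) (Real.one_sub_le_exp_neg _) _
      _ = Real.exp (-(p * (u \ monoSets k g).ncard)) := by
          rw [← Real.exp_nat_mul]; ring_nf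
      _ ≤ Real.exp (-(p * b)) := by
          gcongr
          exact p.2.1
  calc randomEdges k n p {S | (ofEdges S).minMc r ≤ M}
      ≤ ∑ g ∈ T, setBernoulli u p {S | Disjoint S (u \ monoSets k g)} :=
        (measure_mono hsub).trans (measure_biUnion_finset_le _ _)
    _ ≤ T.card • ENNReal.ofReal (Real.exp (-(p * b))) := Finset.sum_le_card_nsmul _ _ _ hterm
    _ ≤ ((m ^ n) ^ r : ℕ) • ENNReal.ofReal (Real.exp (-(p * b))) := by
        refine nsmul_le_nsmul_left zero_le ((Finset.card_le_univ T).trans ?_)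
        simp
    _ = ENNReal.ofReal (Real.exp (r * n * Real.log m - p * b)) := by
        rw [nsmul_eq_mul, ← ENNReal.ofReal_natCast, ← ENNReal.ofReal_mul (Nat.cast_nonneg _),
          sub_eq_add_neg, Real.exp_add]
        congr 2
        have : (r : ℝ) * n * Real.log m = ((n * r : ℕ) : ℝ) * Real.log m := by push_cast; ring
        rw [this, Real.exp_nat_mul, Real.exp_log (by exact_mod_cast hm0), ← pow_mul]
        push_cast
        rfl

end Hypergraph

/-- `C(n, k) ≥ n ^ k / (2 ^ k k!)` for `n ≥ 2 k`. -/
lemma Nat.pow_div_le_choose (n k : ℕ) (h : 2 * k ≤ n) :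
    (n : ℝ) ^ k / (2 ^ k * k.factorial) ≤ n.choose k := by
  refine le_trans ?_ (Nat.pow_le_choose (α := ℝ) k n)
  rw [← div_div, ← div_pow]
  have : (n : ℝ) / 2 ≤ (n + 1 - k : ℕ) := by
    rw [Nat.cast_sub (by omega)]
    have : (2 : ℝ) * k ≤ n := by exact_mod_cast h
    push_cast
    linarith
  gcongr

theorem theorem1p2 (φ : ℕ → ℕ → ℝ)
    (hφ : ∀ k r : ℕ, 2 ≤ k → 1 ≤ r → ∀ α' : ℝ, 0 < α' →
      ∃ ε : ℝ, 0 < ε ∧ ∃ t₀ : ℕ, 0 < t₀ ∧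
        ∀ t : ℕ, t₀ ≤ t → ∀ G : Hypergraph (Fin t), G.vertexSet = Set.univ → G.IsUniform k →
          (1 - ε) * (t.choose k : ℝ) ≤ (G.edgeSet.ncard : ℝ) →
          (φ r k - α') * (t : ℝ) ≤ (G.minMc r : ℝ))
    (k r : ℕ) (hk : 2 ≤ k) (hr : 1 ≤ r) (α : ℝ) (hα : 0 < α) (p : ℕ → unitInterval)
    (hp : Tendsto (fun n : ℕ => (p n : ℝ) * (n : ℝ) ^ (k - 1)) atTop atTop) :
    Tendsto
      (fun n : ℕ => Hypergraph.randomEdges k n (p n)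
        {S | (φ r k - α) * (n : ℝ) ≤ ((Hypergraph.ofEdges S).minMc r : ℝ)})
      atTop (𝓝 1) := by
  have hprob : ∀ n, IsProbabilityMeasure (Hypergraph.randomEdges k n (p n)) := fun n => by
    unfold Hypergraph.randomEdges; infer_instance
  obtain ⟨ε, hε, t₀, ht₀, hG⟩ := hφ k r hk hr (α / 2) (half_pos hα)
  rcases le_or_gt (φ r k - α) 0 with hc | hc
  · refine tendsto_const_nhds.congr fun n => ?_
    rw [← measure_univ (μ := Hypergraph.randomEdges k n (p n))]
    congr 1
    refine (Set.eq_univ_of_forall fun S => ?_).symm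
    exact (mul_nonpos_of_nonpos_of_nonneg hc (Nat.cast_nonneg n)).trans (Nat.cast_nonneg _)
  set c := φ r k - α with hcdef
  -- Since `M + 1 > c * n`, the part count `2 * n / (M + 1) + 1` is at most this, uniformly in `n`.
  set m : ℕ := ⌊2 / c⌋₊ + 1 with hmdef
  set D : ℝ := ε / (2 ^ k * k.factorial) with hD
  have hD0 : 0 < D := by positivity
  let bound : ℕ → ℝ := fun n => n * (r * Real.log m - D * ((p n : ℝ) * (n : ℝ) ^ (k - 1)))
  have hbad : ∀ᶠ n : ℕ in atTop, Hypergraph.randomEdges k n (p n)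
      {S | c * (n : ℝ) ≤ ((Hypergraph.ofEdges S).minMc r : ℝ)}ᶜ ≤
        ENNReal.ofReal (Real.exp (bound n)) := by
    filter_upwards [eventually_ge_atTop t₀, eventually_ge_atTop (2 * k)] with n hn hnk
    have hn0 : (0 : ℝ) < n := by exact_mod_cast (by omega : 0 < n)
    set M := ⌊c * n⌋₊ with hM
    have hMlt : c * n < M + 1 := Nat.lt_floor_add_one _
    have hMle : (M : ℝ) ≤ c * n := Nat.floor_le (by positivity)
    have hm : 2 * n / (M + 1) + 1 ≤ m := by
      refine Nat.succ_le_succ (Nat.le_floor ?_)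
      refine Nat.cast_div_le.trans ?_
      push_cast
      rw [div_le_div_iff₀ (by positivity) hc]
      nlinarith
    refine le_trans (measure_mono ?_) ((Hypergraph.randomEdges_minMc_le (k := k) (M := M) hr hm
      (ε * n.choose k) (p n) ?_).trans (ENNReal.ofReal_le_ofReal (Real.exp_le_exp.2 ?_)))
    · intro S hS
      exact Nat.le_floor (not_le.1 fun h => hS h).le
    · intro g hg
      -- Otherwise the hypothesis, used with `α / 2`, gives `minMc` at least `(c + α / 2) * n`,
      -- above `M ≤ c * n`.
      by_contra hlt
      have h1 := hG n hn (Hypergraph.ofEdges (Hypergraph.monoSets k g)) rfl (fun e he => he.1) (by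
        change _ ≤ ((Hypergraph.monoSets k g).ncard : ℝ)
        linarith [not_le.1 hlt])
      have h2 : ((Hypergraph.ofEdges (Hypergraph.monoSets k g)).minMc r : ℝ) ≤ M := by
        exact_mod_cast Hypergraph.minMc_monoSets_le k M g hg
      have h3 : 0 < α / 2 * n := by positivity
      have h4 : (φ r k - α / 2) * n = c * n + α / 2 * n := by rw [hcdef]; ring
      linarith
    · have h1 := Nat.pow_div_le_choose n k hnk
      have h2 : D * (n : ℝ) ^ k ≤ ε * n.choose k := by
        calc D * (n : ℝ) ^ k = ε * ((n : ℝ) ^ k / (2 ^ k * k.factorial)) := by rw [hD]; ring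
          _ ≤ _ := by gcongr
      have h3 : (n : ℝ) ^ k = n * (n : ℝ) ^ (k - 1) := by
        rw [← pow_succ', Nat.sub_add_cancel (by omega)]
      have h4 := mul_le_mul_of_nonneg_left h2 (p n).2.1
      rw [h3] at h4
      simp only [bound]
      linarith
  have hbound : Tendsto bound atTop atBot := by
    refine Tendsto.atTop_mul_atBot₀ tendsto_natCast_atTop_atTop ?_
    simp only [sub_eq_add_neg]
    exact tendsto_atBot_add_const_left _ _
      (tendsto_neg_atTop_atBot.comp (hp.const_mul_atTop hD0))
  have hzero : Tendsto (fun n => ENNReal.ofReal (Real.exp (bound n))) atTop (𝓝 0) := by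
    simpa using ENNReal.tendsto_ofReal (Real.tendsto_exp_atBot.comp hbound)
  have hlow : Tendsto (fun n => 1 - ENNReal.ofReal (Real.exp (bound n))) atTop (𝓝 1) := by
    simpa using ENNReal.Tendsto.sub (tendsto_const_nhds (x := (1 : ENNReal))) hzero
      (Or.inl ENNReal.one_ne_top)
  refine tendsto_of_tendsto_of_tendsto_of_le_of_le' hlow tendsto_const_nhds ?_
    (Eventually.of_forall fun n => prob_le_one)
  filter_upwards [hbad] with n hn
  -- Subadditivity suffices here, so no measurability of the event is needed.
  rw [tsub_le_iff_right]
  refine le_trans ?_ (add_le_add_right hn _)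
  rw [← measure_univ (μ := Hypergraph.randomEdges k n (p n))]
  rw [← Set.union_compl_self {S | c * (n : ℝ) ≤ ((Hypergraph.ofEdges S).minMc r : ℝ)}]
  exact measure_union_le _ _
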